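/- **Setting.** Let $V$ be a set of $n$ nodes. A linear threshold (LT) network on $V$ is a weight vector $w=(w_{uv})_{u,v\in V}$ with $w_{uv}\ge 0$, $w_{vv}=0$ and $\sum_{u\in V}w_{uv}\le 1$ for every $v$. Its edge set is $E=\{(u,v): w_{uv}>0\}$, $N(v)=\{u: w_{uv}>0\}$ is the set of in-neighbours of $v$, and $D=\max_v|N(v)|$ is the maximum in-degree. In the LT model every node $v$ draws an independent threshold $r_v$ uniform on $[0,1]$; from a seed set $S_0$ one puts $S_\tau=S_{\tau-1}\cup\{v:\sum_{u\in S_{\tau-1}\cap N(v)}w_{uv}\ge r_v\}$, and $\sigma^w(S)=\mathbb E\,[\,|S_{n-1}|\,]$ for $S_0=S$. For a budget $k$, a set $S^*$ is optimal on $w$ if it maximizes $\sigma^w(S)$ over all $S\subseteq V$ with $|S|\le k$. A $\kappa$-approximation algorithm $A$ returns, for every LT network $w$ on $V$ and every $1\le k\le n$, a set $A(w,k)$ of at most $k$ nodes with $\sigma^w(A(w,k))\ge\kappa\,\sigma^w(S^*)$, where $S^*$ is optimal on $w$; nothing is required of $A$ on inputs that are not LT networks. **Cascades.** Fix an LT network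 $w$ and write $\sigma=\sigma^w$. One observes $t$ independent cascades $(S_{i,0},S_{i,1},\dots,S_{i,n-1})$, $1\le i\le t$, of the LT model on $w$, where each $S_{i,0}$ contains each node $u$ independently with probability $q_u$. **Algorithm (IMS-LT).** Put $$\hat q_u=\frac{|\{i:u\in S_{i,0}\}|}{t},\qquad \widehat{ap}(v)=\frac{|\{i:v\in S_{i,1}\}|}{t},\qquad \widehat{ap}(v|\bar u)=\frac{|\{i:u\notin S_{i,0},\,v\in S_{i,1}\}|}{|\{i:u\notin S_{i,0}\}|},$$ $$\hat w_{uv}=\frac{\widehat{ap}(v)-\widehat{ap}(v|\bar u)}{\hat q_u(1-\hat q_v)}$$ (a quotient with denominator $0$ is read as $0$). Let $\varepsilon'=\varepsilon k/(2n^3)$, let $w'_{uv}=\max(0,\hat w_{uv})/(1+\varepsilon'/2)$ for $(u,v)\in E$ and $w'_{uv}=0$ for $(u,v)\notin E$, and return $S^A=A(w',k)$. **Theorem.** Let $\gamma\in(0,1/2]$ and assume $\gamma\le q_u\le 1-\gamma$ for all $u\in V$. Let $\varepsilon,\delta\in(0,1)$, let $k$ be an integer with $1\le k\le n$, let $\kappa\in(0,1]$,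 let $A$ be a $\kappa$-approximation algorithm for influence maximization, and let $S^*$ be an optimal solution with budget $k$ on $w$. If $$t\ \ge\ \frac{4096}{\varepsilon^2\gamma^3}\,\frac{D^2n^6}{k^2}\,\ln\frac{12n}{\delta},$$ then $$\Pr\big[\,|S^A|\le k\ \text{ and }\ \sigma(S^A)\ge(\kappa-\varepsilon)\,\sigma(S^*)\,\big]\ \ge\ 1-\delta .$$ -/

import Mathlib

open MeasureTheory

namespace LinearThreshold

variable {V : Type*} [Fintype V] [DecidableEq V]

/-! ### Networks -/

/-- `w u v` is the weight of the directed edge from `u` to `v`, with `w u v = 0` when there is no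
edge.  The weights are non-negative, there are no self-loops, and every node satisfies the
normalization condition (so in particular `w u v ≤ 1`). -/
structure IsLTWeight (w : V → V → ℝ) : Prop where
  nonneg : ∀ u v, 0 ≤ w u v
  noLoop : ∀ v, w v v = 0
  normalized : ∀ v, ∑ u, w u v ≤ 1

/-- The directed edges of the network: the pairs of positive weight. -/
noncomputable def edges (w : V → V → ℝ) : Finset (V × V) :=
  Finset.univ.filter fun e => 0 < w e.1 e.2

/-- The in-neighbours of `v`. -/
noncomputable def inNeighbors (w : V → V → ℝ) (v : V) : Finset V :=
  Finset.univ.filter fun u => 0 < w u v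

/-- The maximum in-degree of the network. -/
noncomputable def maxInDegree (w : V → V → ℝ) : ℕ :=
  Finset.univ.sup fun v => (inNeighbors w v).card

/-! ### Linear threshold diffusion -/

/-- One time step: an inactive node `v` becomes active when the total weight of its active
in-neighbours reaches its threshold `r v`. -/
noncomputable def step (w : V → V → ℝ) (r : V → ℝ) (S : Finset V) : Finset V :=
  S ∪ Finset.univ.filter fun v => r v ≤ ∑ u ∈ S ∩ inNeighbors w v, w u v

/-- The sequence `τ ↦ S_τ` of active sets with thresholds `r` and seed set `S`. -/
noncomputable def cascade (w : V → V → ℝ) (r : V → ℝ) (S : Finset V) : ℕ → Finset V :=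
  fun τ => (step w r)^[τ] S

/-- Independent thresholds, uniform on `[0, 1]`. -/
noncomputable def thresholdLaw (V : Type*) [Fintype V] : Measure (V → ℝ) :=
  Measure.pi fun _ => (volume : Measure ℝ).restrict (Set.Icc 0 1)

/-- The influence spread `σ^w(S)`: the expected size of the final active set `S_{n-1}`. -/
noncomputable def influence (w : V → V → ℝ) (S : Finset V) : ℝ :=
  ∫ r, ((cascade w r S (Fintype.card V - 1)).card : ℝ) ∂(thresholdLaw V)

/-! ### Influence maximization -/

/-- `S` is an optimal solution of influence maximization with budget `k`. -/
def IsOptimal (w : V → V → ℝ) (k : ℕ) (S : Finset V) : Prop :=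
  S.card ≤ k ∧ ∀ T : Finset V, T.card ≤ k → influence w T ≤ influence w S

/-- `A` is a `κ`-approximation algorithm for influence maximization under the linear threshold
model on the node set `V`.  Nothing is required of `A` on inputs that are not linear threshold
networks. -/
def IsApproxAlgorithm (κ : ℝ) (A : (V → V → ℝ) → ℕ → Finset V) : Prop :=
  ∀ (w : V → V → ℝ) (k : ℕ), IsLTWeight w → 1 ≤ k → k ≤ Fintype.card V →
    (A w k).card ≤ k ∧
      ∀ Sstar : Finset V, IsOptimal w k Sstar → κ * influence w Sstar ≤ influence w (A w k)

/-! ### Independent cascades -/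

/-- The product seed distribution: `u` is a seed (value `true`) with probability `q u`,
independently over all nodes. -/
noncomputable def seedLaw (q : V → ℝ) : Measure (V → Bool) :=
  Measure.pi fun u =>
    ENNReal.ofReal (q u) • Measure.dirac true + ENNReal.ofReal (1 - q u) • Measure.dirac false

/-- The joint law of the seed indicators and thresholds of `t` independent cascades. -/
noncomputable def sampleLaw (q : V → ℝ) (t : ℕ) : Measure (Fin t → (V → Bool) × (V → ℝ)) :=
  Measure.pi fun _ => (seedLaw q).prod (thresholdLaw V)

/-- The `t` cascades observed on the network `w`. -/
noncomputable def observedCascades (w : V → V → ℝ) {t : ℕ}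
    (ω : Fin t → (V → Bool) × (V → ℝ)) : Fin t → ℕ → Finset V :=
  fun i => cascade w (ω i).2 (Finset.univ.filter fun u => (ω i).1 u = true)

/-! ### Learning the edge weights from the cascades `C` -/

section Estimators

variable {t : ℕ} (C : Fin t → ℕ → Finset V)

/-- The fraction of cascades in which `u` is a seed. -/
noncomputable def qHat (u : V) : ℝ :=
  ((Finset.univ.filter fun i => u ∈ C i 0).card : ℝ) / t

/-- The fraction of cascades in which `v` is active after one time step. -/
noncomputable def apHat (v : V) : ℝ :=
  ((Finset.univ.filter fun i => v ∈ C i 1).card : ℝ) / t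

/-- Among the cascades in which `u` is not a seed, the fraction in which `v` is active after one
time step. -/
noncomputable def apHatNot (v u : V) : ℝ :=
  ((Finset.univ.filter fun i => u ∉ C i 0 ∧ v ∈ C i 1).card : ℝ) /
    ((Finset.univ.filter fun i => u ∉ C i 0).card : ℝ)

/-- The estimated weight of the edge from `u` to `v`. -/
noncomputable def wHat (u v : V) : ℝ :=
  (apHat C v - apHatNot C v u) / (qHat C u * (1 - qHat C v))

/-- The surrogate weights on the edge set `E`: negative estimates are replaced by `0`, and all
estimates are divided by `1 + ε' / 2`, where `ε' = ε k / (2 n ^ 3)`. -/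
noncomputable def surrogate (E : Finset (V × V)) (ε : ℝ) (k : ℕ) (u v : V) : ℝ :=
  if (u, v) ∈ E then
    max 0 (wHat C u v) / (1 + (ε * k / (2 * (Fintype.card V : ℝ) ^ 3)) / 2)
  else 0

/-- Influence maximization from samples: learn the surrogate network and run `A` on it. -/
noncomputable def imsLT (A : (V → V → ℝ) → ℕ → Finset V) (E : Finset (V × V)) (ε : ℝ) (k : ℕ) :
    Finset V :=
  A (surrogate C E ε k) k

end Estimators

end LinearThreshold

open MeasureTheory

namespace LinearThreshold

variable {V : Type*} [Fintype V] [DecidableEq V]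

/-! ### Basic facts on cascades -/

/-! Three facts carry the argument.

Stability (`abs_influence_sub_influence_le`): run two networks on the same thresholds. They first
differ at a time `τ` and a node `v` only if `r v` lies between the two weights of the current active
set. Until `v` is active that set does not depend on `r v`, so the chance is at most the `ℓ¹` change
`β` of the in-weights of `v`. Summing over `n` times and `n` nodes, and losing at most `n` nodes on
the bad event, gives `n ^ 3 * β`.

Learning (`measureReal_abs_wHat_sub_le`): let `p` be `probNot`. Node `v` is active after one step
with probability `p` if `u` is not a seed and `p + (1 - q v) * w u v` if it is, so `ap(v) - ap(v |
not u) = q u * (1 - q v) * w u v`. A Bernstein-type bound, whose exponent is linear in the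
probability of the conditioning event, keeps the cost at `γ ^ 3`.

Transfer (`isLTWeight_and_sum_abs_sub_le`, `influence_approx_of_close`): edge errors `η` with `D * η
≤ ε' / 2` add at most `ε' / 2` to each in-weight sum. Division by `1 + ε' / 2` therefore restores an
LT network, on which `A` has its guarantee, and leaves it within `ε'` of `w`. Two uses of stability
cost `2 * n ^ 3 * ε' = ε * k`, and `k ≤ σ(S*)`. -/

theorem sum_inter_inNeighbors {w : V → V → ℝ} (hw : ∀ u v, 0 ≤ w u v) (S : Finset V) (v : V) :
    ∑ u ∈ S ∩ inNeighbors w v, w u v = ∑ u ∈ S, w u v := by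
  refine Finset.sum_subset Finset.inter_subset_left fun u hu hu' => ?_
  have : ¬ 0 < w u v := fun h => hu' (by simp [inNeighbors, hu, h])
  exact le_antisymm (not_lt.mp this) (hw u v)

theorem mem_step {w : V → V → ℝ} (hw : ∀ u v, 0 ≤ w u v) {r : V → ℝ} {S : Finset V} {v : V} :
    v ∈ step w r S ↔ v ∈ S ∨ r v ≤ ∑ u ∈ S, w u v := by
  simp [step, sum_inter_inNeighbors hw]

theorem cascade_succ (w : V → V → ℝ) (r : V → ℝ) (S : Finset V) (τ : ℕ) :
    cascade w r S (τ + 1) = step w r (cascade w r S τ) :=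
  Function.iterate_succ_apply' _ _ _

theorem subset_cascade (w : V → V → ℝ) (r : V → ℝ) (S : Finset V) (τ : ℕ) :
    S ⊆ cascade w r S τ := by
  induction τ with
  | zero => exact Finset.Subset.refl _
  | succ τ ih =>
    rw [cascade_succ]
    exact ih.trans Finset.subset_union_left

/-- Thresholds and seeds both vary with `ω`, which covers fixed seeds, random seeds and modified
thresholds alike. The sum over a random set becomes a sum of indicators. -/
theorem measurableSet_mem_cascade {Ω : Type*} [MeasurableSpace Ω] {w : V → V → ℝ}
    (hw : ∀ u v, 0 ≤ w u v) {r : Ω → V → ℝ} (hr : Measurable r) {S : Ω → Finset V}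
    (hS : ∀ v, MeasurableSet {ω | v ∈ S ω}) (τ : ℕ) (v : V) :
    MeasurableSet {ω | v ∈ cascade w (r ω) (S ω) τ} := by
  induction τ generalizing v with
  | zero => exact hS v
  | succ τ ih =>
    have h : {ω | v ∈ cascade w (r ω) (S ω) (τ + 1)} = {ω | v ∈ cascade w (r ω) (S ω) τ} ∪
        {ω | r ω v ≤ ∑ u, Set.indicator {ω | u ∈ cascade w (r ω) (S ω) τ} (fun _ => w u v) ω} := by
      ext ω
      simp [cascade_succ, mem_step hw, Set.indicator_apply, Finset.sum_ite_mem]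
    rw [h]
    refine (ih v).union (measurableSet_le (measurable_pi_apply v |>.comp hr) ?_)
    exact Finset.measurable_fun_sum _ fun u _ => measurable_const.indicator (ih u)

theorem measurable_card_cascade {w : V → V → ℝ} (hw : ∀ u v, 0 ≤ w u v) (S : Finset V) (τ : ℕ) :
    Measurable fun r : V → ℝ => ((cascade w r S τ).card : ℝ) := by
  have h : (fun r : V → ℝ => ((cascade w r S τ).card : ℝ)) =
      fun r => ∑ u, Set.indicator {r : V → ℝ | u ∈ cascade w r S τ} (fun _ => (1 : ℝ)) r := by
    ext r
    simp [Set.indicator_apply]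
  rw [h]
  exact Finset.measurable_fun_sum _ fun u _ => measurable_const.indicator
    (measurableSet_mem_cascade hw measurable_id (fun v => MeasurableSet.const _) τ u)

instance isProbabilityMeasure_uniform :
    IsProbabilityMeasure ((volume : Measure ℝ).restrict (Set.Icc 0 1)) := ⟨by simp⟩

instance isProbabilityMeasure_thresholdLaw : IsProbabilityMeasure (thresholdLaw V) := by
  unfold thresholdLaw; infer_instance

theorem integrable_card_cascade {w : V → V → ℝ} (hw : ∀ u v, 0 ≤ w u v) (S : Finset V) (τ : ℕ) :
    Integrable (fun r : V → ℝ => ((cascade w r S τ).card : ℝ)) (thresholdLaw V) := by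
  refine Integrable.of_bound (measurable_card_cascade hw S τ).aestronglyMeasurable
    (Fintype.card V) (ae_of_all _ fun r => ?_)
  simpa using Finset.card_le_univ _

theorem card_le_influence {w : V → V → ℝ} (hw : ∀ u v, 0 ≤ w u v) (S : Finset V) :
    (S.card : ℝ) ≤ influence w S := by
  have h : ∫ _ : V → ℝ, (S.card : ℝ) ∂(thresholdLaw V) = S.card := by simp
  rw [← h]
  refine integral_mono (integrable_const _) (integrable_card_cascade hw S _) fun r => ?_
  exact Nat.cast_le.mpr (Finset.card_le_card (subset_cascade w r S _))

/-- The guarantee of `A` on the surrogate network is relative to an optimum there, so one has to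
exist. -/
theorem exists_isOptimal (w : V → V → ℝ) (k : ℕ) : ∃ S, IsOptimal w k S := by
  obtain ⟨S, hS, h⟩ := Finset.exists_max_image
    (Finset.univ.filter fun S : Finset V => S.card ≤ k) (influence w) ⟨∅, by simp⟩
  exact ⟨S, by simpa using hS, fun T hT => h T (by simpa using hT)⟩

/-! ### Stability of the influence spread under perturbations of the weights -/

/-- A node that is not active at time `τ` has had no effect on the cascade, so its threshold may be
replaced by an unreachable one. -/
theorem cascade_update_of_notMem {w : V → V → ℝ} (hw : IsLTWeight w) {r : V → ℝ} {S : Finset V}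
    {τ : ℕ} {v : V} (hv : v ∉ cascade w r S τ) :
    cascade w (Function.update r v 2) S τ = cascade w r S τ := by
  induction τ with
  | zero => rfl
  | succ τ ih =>
    have hv' := hv
    rw [cascade_succ, mem_step hw.nonneg, not_or] at hv'
    rw [cascade_succ, cascade_succ, ih hv'.1]
    ext x
    rw [mem_step hw.nonneg, mem_step hw.nonneg]
    rcases eq_or_ne x v with rfl | hx
    · have h2 : ¬ (2 : ℝ) ≤ ∑ u ∈ cascade w r S τ, w u x := by
        have := (Finset.sum_le_univ_sum_of_nonneg (s := cascade w r S τ)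
          (fun u => hw.nonneg u x)).trans (hw.normalized x)
        linarith
      simp [h2, hv'.2]
    · simp [hx]

/-- The threshold vectors for which the weights `w` and `w'` disagree on the activation of the node
`v` by the nodes active at time `τ`. -/
def disagreement (w w' : V → V → ℝ) (S : Finset V) (τ : ℕ) (v : V) : Set (V → ℝ) :=
  {r | ¬ (r v ≤ ∑ u ∈ cascade w (Function.update r v 2) S τ, w u v ↔
    r v ≤ ∑ u ∈ cascade w (Function.update r v 2) S τ, w' u v)}

theorem measurableSet_disagreement {w w' : V → V → ℝ} (hw : ∀ u v, 0 ≤ w u v) (S : Finset V)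
    (τ : ℕ) (v : V) : MeasurableSet (disagreement w w' S τ v) := by
  have hc : ∀ u, MeasurableSet
      {r : V → ℝ | u ∈ cascade w (Function.update r v 2) S τ} := fun u =>
    measurableSet_mem_cascade hw (measurable_pi_iff.mpr fun a => by
      by_cases h : a = v
      · subst h; simp
      · simpa [h] using measurable_pi_apply a)
      (fun v => MeasurableSet.const _) τ u
  have h : ∀ w'' : V → V → ℝ, MeasurableSet
      {r : V → ℝ | r v ≤ ∑ u ∈ cascade w (Function.update r v 2) S τ, w'' u v} := by
    intro w''
    have : {r : V → ℝ | r v ≤ ∑ u ∈ cascade w (Function.update r v 2) S τ, w'' u v} =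
        {r | r v ≤ ∑ u, Set.indicator {r : V → ℝ | u ∈ cascade w (Function.update r v 2) S τ}
          (fun _ => w'' u v) r} := by
      ext r
      simp [Set.indicator_apply, Finset.sum_ite_mem]
    rw [this]
    exact measurableSet_le (measurable_pi_apply v)
      (Finset.measurable_fun_sum _ fun u _ => measurable_const.indicator (hc u))
  have h1 := h w
  have h2 := h w'
  exact ((h1.mem.iff h2.mem).not).setOf

/-- With the other thresholds fixed, disagreement confines `r v` to an interval of length at most
`β` between two sums over the same set. -/
theorem thresholdLaw_disagreement_le {w w' : V → V → ℝ} (hw : ∀ u v, 0 ≤ w u v) {β : ℝ}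
    (hβ : ∀ v, ∑ u, |w u v - w' u v| ≤ β) (S : Finset V) (τ : ℕ) (v : V) :
    thresholdLaw V (disagreement w w' S τ v) ≤ ENNReal.ofReal β := by
  have hm := measurableSet_disagreement (w' := w') hw S τ v
  have hf : Measurable ((disagreement w w' S τ v).indicator (fun _ => (1 : ENNReal))) :=
    measurable_const.indicator hm
  rw [← lintegral_indicator_one hm, thresholdLaw]
  change ∫⁻ r, (disagreement w w' S τ v).indicator (fun _ => (1 : ENNReal)) r ∂_ ≤ _
  -- Fubini with coordinate `v` innermost: the active set `T` below is computed with threshold 2 at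
  -- `v`, hence is constant in that coordinate.
  rw [lintegral_eq_lmarginal_univ (fun _ => (0 : ℝ)),
    lmarginal_erase' _ hf (Finset.mem_univ v)]
  refine (lmarginal_mono (g := fun _ => ENNReal.ofReal β) (fun r => ?_) _).trans
    (by simp [lmarginal])
  set T := cascade w (Function.update r v 2) S τ with hT
  have hsub : ∀ y, (disagreement w w' S τ v).indicator (fun _ => (1 : ENNReal))
      (Function.update r v y) ≤
      (Set.uIcc (∑ u ∈ T, w u v) (∑ u ∈ T, w' u v)).indicator 1 y := by
    intro y
    by_cases h : Function.update r v y ∈ disagreement w w' S τ v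
    · have hy : y ∈ Set.uIcc (∑ u ∈ T, w u v) (∑ u ∈ T, w' u v) := by
        simp only [disagreement, Set.mem_ofPred_eq, Function.update_self, Function.update_idem,
          ← hT] at h
        rw [Set.mem_uIcc]
        grind
      simp [h, hy]
    · simp [h]
  calc _ ≤ ∫⁻ y, (Set.uIcc (∑ u ∈ T, w u v) (∑ u ∈ T, w' u v)).indicator 1 y
        ∂((volume : Measure ℝ).restrict (Set.Icc 0 1)) := lintegral_mono hsub
    _ ≤ volume (Set.uIcc (∑ u ∈ T, w u v) (∑ u ∈ T, w' u v)) := by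
        rw [lintegral_indicator_one measurableSet_uIcc]
        exact Measure.restrict_apply_le _ _
    _ ≤ ENNReal.ofReal β := by
        rw [Real.volume_interval]
        refine ENNReal.ofReal_le_ofReal ?_
        rw [abs_sub_comm, ← Finset.sum_sub_distrib]
        exact (Finset.abs_sum_le_sum_abs _ _).trans
          ((Finset.sum_le_univ_sum_of_nonneg fun _ => abs_nonneg _).trans (hβ v))

/-- Induction on time: for a node still inactive, the modified cascade in `disagreement` is the true
one, so both networks take the same decision. -/
theorem cascade_eq_of_notMem_disagreement {w w' : V → V → ℝ} (hw : IsLTWeight w)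
    (hw' : ∀ u v, 0 ≤ w' u v) {r : V → ℝ} {S : Finset V} {m : ℕ}
    (h : ∀ τ < m, ∀ v, r ∉ disagreement w w' S τ v) :
    cascade w r S m = cascade w' r S m := by
  induction m with
  | zero => rfl
  | succ m ih =>
    have ih := ih fun τ hτ => h τ (hτ.trans (Nat.lt_succ_self m))
    rw [cascade_succ, cascade_succ, ← ih]
    ext v
    rw [mem_step hw.nonneg, mem_step hw']
    by_cases hv : v ∈ cascade w r S m
    · simp [hv]
    · have := h m (Nat.lt_succ_self m) v
      simp only [disagreement, Set.mem_ofPred_eq, not_not, cascade_update_of_notMem hw hv] at this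
      simp [hv, this]

/-- If the in-weights of every node change by at most `β` in total, then the influence spread of a
set changes by at most `n ^ 3 * β`. -/
theorem abs_influence_sub_influence_le {w w' : V → V → ℝ} (hw : IsLTWeight w)
    (hw' : ∀ u v, 0 ≤ w' u v) {β : ℝ} (hβ0 : 0 ≤ β)
    (hβ : ∀ v, ∑ u, |w u v - w' u v| ≤ β) (S : Finset V) :
    |influence w S - influence w' S| ≤ (Fintype.card V : ℝ) ^ 3 * β := by
  set n := Fintype.card V with hn
  -- Only times below `n - 1` matter; `n` of them are counted for a cleaner bound.
  set B : Set (V → ℝ) := ⋃ τ ∈ Finset.range n, ⋃ v ∈ (Finset.univ : Finset V),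
    disagreement w w' S τ v with hB
  have hBm : MeasurableSet B := Finset.measurableSet_biUnion _ fun τ _ =>
    Finset.measurableSet_biUnion _ fun v _ => measurableSet_disagreement hw.nonneg S τ v
  have hPB : (thresholdLaw V).real B ≤ n * (n * β) := by
    refine (measureReal_biUnion_finset_le _ _).trans ?_
    have : ∀ τ ∈ Finset.range n, (thresholdLaw V).real
        (⋃ v ∈ (Finset.univ : Finset V), disagreement w w' S τ v) ≤ n * β := by
      intro τ _
      refine (measureReal_biUnion_finset_le _ _).trans ?_
      refine (Finset.sum_le_card_nsmul _ _ β fun v _ => ?_).trans (by simp [hn])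
      exact ENNReal.toReal_le_of_le_ofReal hβ0 (thresholdLaw_disagreement_le hw.nonneg hβ S τ v)
    exact (Finset.sum_le_card_nsmul _ _ _ this).trans (by simp)
  have hpt : ∀ r, |((cascade w r S (n - 1)).card : ℝ) - (cascade w' r S (n - 1)).card| ≤
      B.indicator (fun _ => (n : ℝ)) r := by
    intro r
    by_cases hr : r ∈ B
    · rw [Set.indicator_of_mem hr]
      have h1 : ((cascade w r S (n - 1)).card : ℝ) ≤ n := by exact_mod_cast Finset.card_le_univ _
      have h2 : ((cascade w' r S (n - 1)).card : ℝ) ≤ n := by exact_mod_cast Finset.card_le_univ _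
      have h3 : (0 : ℝ) ≤ (cascade w r S (n - 1)).card := Nat.cast_nonneg _
      have h4 : (0 : ℝ) ≤ (cascade w' r S (n - 1)).card := Nat.cast_nonneg _
      exact abs_le.mpr ⟨by linarith, by linarith⟩
    · rw [Set.indicator_of_notMem hr, cascade_eq_of_notMem_disagreement hw hw', sub_self, abs_zero]
      intro τ hτ v hmem
      exact hr (Set.mem_biUnion (Finset.mem_range.mpr (by omega : τ < n))
        (Set.mem_biUnion (Finset.mem_univ v) hmem))
  unfold influence
  rw [← integral_sub (integrable_card_cascade hw.nonneg S _) (integrable_card_cascade hw' S _)]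
  calc _ ≤ ∫ r, |((cascade w r S (n - 1)).card : ℝ) - (cascade w' r S (n - 1)).card|
        ∂(thresholdLaw V) := abs_integral_le_integral_abs
    _ ≤ ∫ r, B.indicator (fun _ => (n : ℝ)) r ∂(thresholdLaw V) :=
        integral_mono ((integrable_card_cascade hw.nonneg S _).sub
          (integrable_card_cascade hw' S _)).abs ((integrable_const _).indicator hBm) hpt
    _ = (thresholdLaw V).real B * n := by
        rw [integral_indicator_const _ hBm, smul_eq_mul]
    _ ≤ n * (n * β) * n := by gcongr
    _ = (n : ℝ) ^ 3 * β := by ring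

/-! ### A concentration inequality of Bernstein type -/

/-- Uses `exp x ≤ 1 + x + x ^ 2` on `|x| ≤ 1` and `X ^ 2 ≤ |X|`. The first absolute moment stands in
for the variance; it is small when `X` vanishes outside a rare event. -/
theorem integral_exp_mul_le {Ω : Type*} [MeasurableSpace Ω] {P : Measure Ω}
    [IsProbabilityMeasure P] {X : Ω → ℝ} (hX : Measurable X) (hX1 : ∀ ω, |X ω| ≤ 1)
    (hX0 : ∫ ω, X ω ∂P = 0) {s : ℝ} (hs : ∫ ω, |X ω| ∂P ≤ s) {l : ℝ} (hl0 : 0 ≤ l) (hl1 : l ≤ 1) :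
    ∫ ω, Real.exp (l * X ω) ∂P ≤ Real.exp (s * l ^ 2) := by
  have hlX : ∀ ω, |l * X ω| ≤ 1 := fun ω => by
    rw [abs_mul, abs_of_nonneg hl0]
    exact mul_le_one₀ hl1 (abs_nonneg _) (hX1 ω)
  have hiX : Integrable X P := Integrable.of_bound hX.aestronglyMeasurable 1 (ae_of_all _ hX1)
  have hie : Integrable (fun ω => Real.exp (l * X ω)) P := by
    refine Integrable.of_bound (by fun_prop) (Real.exp 1) (ae_of_all _ fun ω => ?_)
    rw [Real.norm_eq_abs, Real.abs_exp]
    exact Real.exp_le_exp.mpr (le_of_abs_le (hlX ω))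
  have hpt : ∀ ω, Real.exp (l * X ω) ≤ 1 + l * X ω + l ^ 2 * |X ω| := fun ω => by
    have h1 := le_of_abs_le (Real.abs_exp_sub_one_sub_id_le (hlX ω))
    have h2 : (X ω) ^ 2 ≤ |X ω| := by
      rw [← sq_abs]
      exact pow_le_of_le_one (abs_nonneg _) (hX1 ω) two_ne_zero
    have h3 := mul_le_mul_of_nonneg_left h2 (sq_nonneg l)
    linarith [mul_pow l (X ω) 2]
  calc ∫ ω, Real.exp (l * X ω) ∂P ≤ ∫ ω, (1 + l * X ω + l ^ 2 * |X ω|) ∂P :=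
        integral_mono hie (((integrable_const _).add (hiX.const_mul l)).add
          (hiX.abs.const_mul _)) hpt
    _ = 1 + l ^ 2 * ∫ ω, |X ω| ∂P := by
        have hi : Integrable (fun ω => 1 + l * X ω) P :=
          (integrable_const _).add (hiX.const_mul l)
        rw [integral_add hi (hiX.abs.const_mul _),
          integral_add (integrable_const _) (hiX.const_mul l), integral_const_mul,
          integral_const_mul, hX0]
        simp
    _ ≤ s * l ^ 2 + 1 := by nlinarith [mul_le_mul_of_nonneg_left hs (sq_nonneg l)]
    _ ≤ Real.exp (s * l ^ 2) := Real.add_one_le_exp _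

/-- Chernoff's method: Markov's inequality for the exponential moment, which factors over the
independent coordinates. -/
theorem measureReal_le_sum_le {Ω : Type*} [MeasurableSpace Ω] {P : Measure Ω}
    [IsProbabilityMeasure P] {X : Ω → ℝ} (hX : Measurable X) (hX1 : ∀ ω, |X ω| ≤ 1)
    (hX0 : ∫ ω, X ω ∂P = 0) {s : ℝ} (hs : ∫ ω, |X ω| ∂P ≤ s) {l : ℝ} (hl0 : 0 ≤ l) (hl1 : l ≤ 1)
    (t : ℕ) (a : ℝ) :
    (Measure.pi fun _ : Fin t => P).real {ω | a ≤ ∑ i, X (ω i)} ≤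
      Real.exp (-(l * a) + t * (s * l ^ 2)) := by
  have hie : Integrable (fun ω : Fin t → Ω => Real.exp (l * ∑ i, X (ω i)))
      (Measure.pi fun _ : Fin t => P) := by
    have hm : Measurable fun ω : Fin t → Ω => Real.exp (l * ∑ i, X (ω i)) :=
      ((Finset.measurable_fun_sum _ fun i _ =>
        hX.comp (measurable_pi_apply i)).const_mul l).exp
    refine Integrable.of_bound hm.aestronglyMeasurable (Real.exp t) (ae_of_all _ fun ω => ?_)
    rw [Real.norm_eq_abs, Real.abs_exp]
    have h : ∑ i, X (ω i) ≤ t := by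
      refine (Finset.sum_le_card_nsmul _ _ 1 fun i _ => le_of_abs_le (hX1 _)).trans (by simp)
    have ht : (0 : ℝ) ≤ t := Nat.cast_nonneg t
    exact Real.exp_le_exp.mpr (by nlinarith)
  refine (ProbabilityTheory.measure_ge_le_exp_mul_mgf a hl0 hie).trans ?_
  rw [ProbabilityTheory.mgf]
  simp_rw [Finset.mul_sum, Real.exp_sum]
  rw [integral_fintype_prod_eq_pow (ι := Fin t) (fun x => Real.exp (l * X x)), Fintype.card_fin,
    Real.exp_add, Real.exp_nat_mul, neg_mul]
  gcongr
  exact integral_exp_mul_le hX hX1 hX0 hs hl0 hl1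

/-- The two-sided inequality, with the exponent optimized. -/
theorem measureReal_le_abs_sum_le {Ω : Type*} [MeasurableSpace Ω] {P : Measure Ω}
    [IsProbabilityMeasure P] {X : Ω → ℝ} (hX : Measurable X) (hX1 : ∀ ω, |X ω| ≤ 1)
    (hX0 : ∫ ω, X ω ∂P = 0) {s : ℝ} (hs : ∫ ω, |X ω| ∂P ≤ s) {c : ℝ} (hc0 : 0 ≤ c) (hc1 : c ≤ 2)
    (t : ℕ) :
    (Measure.pi fun _ : Fin t => P).real {ω | t * s * c < |∑ i, X (ω i)|} ≤
      2 * Real.exp (-(t * s * c ^ 2 / 4)) := by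
  -- The exponent `-l * t * s * c + t * s * l ^ 2` is smallest at `l = c / 2`, and `c ≤ 2` keeps `l
  -- ≤ 1`.
  have h1 := measureReal_le_sum_le hX hX1 hX0 hs (l := c / 2) (by linarith) (by linarith) t
    (t * s * c)
  have h2 := measureReal_le_sum_le (X := fun ω => -X ω) hX.neg (by simpa using hX1)
    (by rw [integral_neg, hX0, neg_zero]) (by simpa using hs) (l := c / 2) (by linarith)
    (by linarith) t (t * s * c)
  have he : -(c / 2 * (t * s * c)) + t * (s * (c / 2) ^ 2) = -(t * s * c ^ 2 / 4) := by ring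
  rw [he] at h1 h2
  refine (measureReal_mono (s₂ := {ω | t * s * c ≤ ∑ i, X (ω i)} ∪
    {ω | t * s * c ≤ ∑ i, -X (ω i)}) (fun ω hω => ?_)).trans
    ((measureReal_union_le _ _).trans (by linarith))
  rw [Set.mem_union, Set.mem_ofPred_eq, Set.mem_ofPred_eq, Finset.sum_neg_distrib]
  exact (lt_abs.mp hω).imp le_of_lt le_of_lt

/-! ### One cascade: the seeds and the activations after one step -/

/-- The law of a single seed indicator. -/
noncomputable def coin (p : ℝ) : Measure Bool :=
  ENNReal.ofReal p • Measure.dirac true + ENNReal.ofReal (1 - p) • Measure.dirac false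

theorem isProbabilityMeasure_coin {p : ℝ} (h0 : 0 ≤ p) (h1 : p ≤ 1) :
    IsProbabilityMeasure (coin p) := ⟨by
  simp only [coin, Measure.coe_add, Measure.coe_smul, Pi.add_apply, Pi.smul_apply, measure_univ,
    smul_eq_mul, mul_one]
  rw [← ENNReal.ofReal_add h0 (by linarith)]
  simp⟩

theorem integral_coin {p : ℝ} (h0 : 0 ≤ p) (h1 : p ≤ 1) (f : Bool → ℝ) :
    ∫ b, f b ∂(coin p) = p * f true + (1 - p) * f false := by
  have := isProbabilityMeasure_coin h0 h1
  rw [coin, integral_add_measure, integral_smul_measure, integral_smul_measure, integral_dirac,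
    integral_dirac, ENNReal.toReal_ofReal h0, ENNReal.toReal_ofReal (by linarith), smul_eq_mul,
    smul_eq_mul]
  · exact (integrable_dirac (by simp)).smul_measure ENNReal.ofReal_ne_top
  · exact (integrable_dirac (by simp)).smul_measure ENNReal.ofReal_ne_top

omit [DecidableEq V] in
theorem isProbabilityMeasure_seedLaw {q : V → ℝ} (h0 : ∀ u, 0 ≤ q u) (h1 : ∀ u, q u ≤ 1) :
    IsProbabilityMeasure (seedLaw q) := by
  have := fun u => isProbabilityMeasure_coin (h0 u) (h1 u)
  exact inferInstanceAs (IsProbabilityMeasure (Measure.pi fun u => coin (q u)))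

omit [DecidableEq V] in
theorem integrable_seedLaw {q : V → ℝ} (h0 : ∀ u, 0 ≤ q u) (h1 : ∀ u, q u ≤ 1)
    (f : (V → Bool) → ℝ) : Integrable f (seedLaw q) := by
  have := isProbabilityMeasure_seedLaw h0 h1
  exact Integrable.of_finite

theorem integral_seedLaw_prod {q : V → ℝ} (h0 : ∀ u, 0 ≤ q u) (h1 : ∀ u, q u ≤ 1)
    (s : Finset V) (f : V → Bool → ℝ) :
    ∫ x, ∏ u ∈ s, f u (x u) ∂(seedLaw q) = ∏ u ∈ s, (q u * f u true + (1 - q u) * f u false) := by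
  have := fun u => isProbabilityMeasure_coin (h0 u) (h1 u)
  have h := integral_fintype_prod_eq_prod (μ := fun u => coin (q u))
    (fun u b => if u ∈ s then f u b else 1)
  have hs : seedLaw q = Measure.pi fun u => coin (q u) := rfl
  simp only [Finset.prod_ite_mem, Finset.univ_inter] at h
  rw [hs, h]
  conv_rhs => rw [← Finset.univ_inter s, ← Finset.prod_ite_mem]
  refine Finset.prod_congr rfl fun u _ => ?_
  rw [integral_coin (h0 u) (h1 u)]
  split_ifs <;> ring

/-- The seed indicator as a real number. -/
def bit (b : Bool) : ℝ := if b then 1 else 0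

/-- The probability that `v` is active after one step when the seeds are given by `x`. -/
noncomputable def activationProb (w : V → V → ℝ) (v : V) (x : V → Bool) : ℝ :=
  bit (x v) + (1 - bit (x v)) * ∑ u, w u v * bit (x u)

/-- The probability that `v` is active after one step when `u` is not a seed. -/
noncomputable def probNot (w : V → V → ℝ) (q : V → ℝ) (u v : V) : ℝ :=
  q v + (1 - q v) * ∑ a ∈ Finset.univ.erase u, w a v * q a

/-- Expand `activationProb` in the independent seed indicators: among the weighted terms with `a ≠
v`, only `a = u` is correlated with `g (x u)`, which isolates `w u v`. The term `a = v` vanishes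
because there are no loops. The cases `g = bit` and `g = 1 - bit` give the means with and without
the seed `u`. -/
theorem integral_seedLaw_mul_activationProb {w : V → V → ℝ} (hw : IsLTWeight w) {q : V → ℝ}
    (h0 : ∀ u, 0 ≤ q u) (h1 : ∀ u, q u ≤ 1) {u v : V} (huv : u ≠ v) (g : Bool → ℝ) :
    ∫ x, g (x u) * activationProb w v x ∂(seedLaw q) =
      (q u * g true + (1 - q u) * g false) * probNot w q u v +
        (1 - q v) * w u v * (q u * g true) := by
  have hpair : ∫ x, g (x u) * bit (x v) ∂(seedLaw q) =
      (q u * g true + (1 - q u) * g false) * q v := by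
    have h := integral_seedLaw_prod h0 h1 {u, v} (fun a => if a = u then g else bit)
    simpa [Finset.prod_pair huv, huv.symm, bit] using h
  have hself : ∫ x, g (x u) * ((1 - bit (x v)) * bit (x u)) ∂(seedLaw q) =
      q u * g true * (1 - q v) := by
    have h := integral_seedLaw_prod h0 h1 {u, v}
      (fun a => if a = u then fun b => g b * bit b else fun b => 1 - bit b)
    simp only [Finset.prod_pair huv, huv.symm, if_true, if_false] at h
    rw [show q u * g true * (1 - q v) = (q u * (g true * bit true) + (1 - q u) *
      (g false * bit false)) * (q v * (1 - bit true) + (1 - q v) * (1 - bit false)) by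
        simp [bit], ← h]
    exact integral_congr_ae (ae_of_all _ fun x => by ring)
  have htriple : ∀ a, a ≠ u → a ≠ v → ∫ x, g (x u) * ((1 - bit (x v)) * bit (x a)) ∂(seedLaw q) =
      (q u * g true + (1 - q u) * g false) * ((1 - q v) * q a) := by
    intro a hau hav
    have h := integral_seedLaw_prod h0 h1 {u, v, a}
      (fun c => if c = u then g else if c = v then fun b => 1 - bit b else bit)
    rw [Finset.prod_insert (by simp [huv, hau.symm]),
      Finset.prod_pair hav.symm] at h
    simpa [Finset.prod_insert, huv, huv.symm, hau, hav, hau.symm, hav.symm, bit] using h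
  have hterm : ∀ a, w a v * ∫ x, g (x u) * ((1 - bit (x v)) * bit (x a)) ∂(seedLaw q) =
      if a = u then w u v * (q u * g true * (1 - q v)) else
        (q u * g true + (1 - q u) * g false) * ((1 - q v) * (w a v * q a)) := by
    intro a
    split_ifs with hau
    · rw [hau, hself]
    · by_cases hav : a = v
      · rw [hav, hw.noLoop]; ring
      · rw [htriple a hau hav]; ring
  have hexp : ∀ x, g (x u) * activationProb w v x = g (x u) * bit (x v) +
      ∑ a, w a v * (g (x u) * ((1 - bit (x v)) * bit (x a))) := by
    intro x
    rw [activationProb, mul_add, Finset.mul_sum, Finset.mul_sum]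
    congr 1
    exact Finset.sum_congr rfl fun a _ => by ring
  simp_rw [hexp]
  rw [integral_add (integrable_seedLaw h0 h1 _) (integrable_seedLaw h0 h1 _),
    integral_finsetSum _ fun a _ => integrable_seedLaw h0 h1 _, hpair]
  simp_rw [integral_const_mul, hterm]
  rw [← Finset.add_sum_erase _ _ (Finset.mem_univ u), if_pos rfl,
    Finset.sum_congr rfl (fun a ha => if_neg (Finset.ne_of_mem_erase ha)), ← Finset.mul_sum,
    ← Finset.mul_sum, probNot]
  ring

/-- The indicator that `u` is a seed. -/
def seedInd (u : V) (p : (V → Bool) × (V → ℝ)) : ℝ := bit (p.1 u)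

/-- The indicator that `v` is active after one step. -/
noncomputable def actInd (w : V → V → ℝ) (v : V) (p : (V → Bool) × (V → ℝ)) : ℝ :=
  if v ∈ cascade w p.2 (Finset.univ.filter fun u => p.1 u = true) 1 then 1 else 0

omit [Fintype V] [DecidableEq V] in
theorem measurable_seedInd (u : V) : Measurable (seedInd (V := V) u) :=
  (measurable_of_countable bit).comp ((measurable_pi_apply u).comp measurable_fst)

theorem measurable_actInd {w : V → V → ℝ} (hw : ∀ u v, 0 ≤ w u v) (v : V) :
    Measurable (actInd w v) := by
  refine Measurable.ite (measurableSet_mem_cascade hw measurable_snd (fun u => ?_) 1 v)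
    measurable_const measurable_const
  simp only [Finset.mem_filter, Finset.mem_univ, true_and]
  exact measurableSet_eq_fun ((measurable_pi_apply u).comp measurable_fst) measurable_const

omit [Fintype V] [DecidableEq V] in
theorem seedInd_mem (u : V) (p : (V → Bool) × (V → ℝ)) : seedInd u p ∈ Set.Icc (0 : ℝ) 1 := by
  unfold seedInd bit; split_ifs <;> simp

theorem actInd_mem (w : V → V → ℝ) (v : V) (p : (V → Bool) × (V → ℝ)) :
    actInd w v p ∈ Set.Icc (0 : ℝ) 1 := by
  unfold actInd; split_ifs <;> simp

/-- A non-seed is activated when its uniform threshold is at most the seeded in-weight `c`;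
normalization gives `c ≤ 1`, so the probability is exactly `c`. -/
theorem integral_actInd {w : V → V → ℝ} (hw : IsLTWeight w) (v : V) (x : V → Bool) :
    ∫ r, actInd w v (x, r) ∂(thresholdLaw V) = activationProb w v x := by
  set c := ∑ u, w u v * bit (x u) with hc
  have hc0 : 0 ≤ c := Finset.sum_nonneg fun u _ =>
    mul_nonneg (hw.nonneg u v) (by unfold bit; split_ifs <;> simp)
  have hc1 : c ≤ 1 := (Finset.sum_le_sum fun u _ => mul_le_of_le_one_right (hw.nonneg u v)
    (by unfold bit; split_ifs <;> simp)).trans (hw.normalized v)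
  have hact : ∀ r, actInd w v (x, r) = if x v = true ∨ r v ≤ c then 1 else 0 := by
    intro r
    have : ∑ u ∈ Finset.univ.filter (fun u => x u = true), w u v = c := by
      simp [hc, bit, Finset.sum_filter]
    simp only [actInd, cascade, Function.iterate_one, mem_step hw.nonneg, this, Finset.mem_filter,
      Finset.mem_univ, true_and]
  by_cases hx : x v = true
  · simp [hact, hx, activationProb, bit]
  · have hm : MeasurableSet (Set.Iic c) := measurableSet_Iic
    have hf : ∀ r : V → ℝ, actInd w v (x, r) = (Set.Iic c).indicator (fun _ => (1 : ℝ)) (r v) := by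
      intro r
      simp [hact, hx, Set.indicator_apply]
    simp_rw [hf]
    have hmp := measurePreserving_eval
      (fun _ : V => (volume : Measure ℝ).restrict (Set.Icc 0 1)) v
    have hI : Set.Iic c ∩ Set.Icc 0 1 = Set.Icc 0 c := by
      ext y; simp only [Set.mem_inter_iff, Set.mem_Iic, Set.mem_Icc]
      constructor
      · rintro ⟨h, h', -⟩; exact ⟨h', h⟩
      · rintro ⟨h, h'⟩; exact ⟨h', h, h'.trans hc1⟩
    rw [thresholdLaw, ← integral_map (φ := fun r : V → ℝ => r v) (measurable_pi_apply v).aemeasurable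
      (measurable_const.indicator hm).aestronglyMeasurable,
      show Measure.map (fun r : V → ℝ => r v) _ = _ from hmp.map_eq,
      integral_indicator_const _ hm, measureReal_restrict_apply hm, hI, Real.volume_real_Icc]
    rw [activationProb, ← hc]
    simp [bit, hx, hc0]

theorem integral_mul_actInd {w : V → V → ℝ} (hw : IsLTWeight w) {q : V → ℝ}
    (h0 : ∀ u, 0 ≤ q u) (h1 : ∀ u, q u ≤ 1) {u v : V} (huv : u ≠ v) (g : Bool → ℝ) :
    ∫ p, g (p.1 u) * actInd w v p ∂((seedLaw q).prod (thresholdLaw V)) =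
      (q u * g true + (1 - q u) * g false) * probNot w q u v +
        (1 - q v) * w u v * (q u * g true) := by
  have := isProbabilityMeasure_seedLaw h0 h1
  rw [integral_prod]
  · simp_rw [integral_const_mul, integral_actInd hw]
    exact integral_seedLaw_mul_activationProb hw h0 h1 huv g
  · have hg : Measurable fun p : (V → Bool) × (V → ℝ) => g (p.1 u) :=
      (measurable_of_countable g).comp ((measurable_pi_apply u).comp measurable_fst)
    refine Integrable.of_bound (hg.mul (measurable_actInd hw.nonneg v)).aestronglyMeasurable
      (|g true| + |g false|) (ae_of_all _ fun p => ?_)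
    rw [norm_mul, Real.norm_eq_abs, Real.norm_eq_abs, abs_of_nonneg (actInd_mem w v p).1]
    refine (mul_le_of_le_one_right (abs_nonneg _) (actInd_mem w v p).2).trans ?_
    cases p.1 u <;> simp

theorem integral_bit_comp {q : V → ℝ} (h0 : ∀ u, 0 ≤ q u) (h1 : ∀ u, q u ≤ 1) (u : V)
    (g : Bool → ℝ) :
    ∫ p, g (p.1 u) ∂((seedLaw q).prod (thresholdLaw V)) = q u * g true + (1 - q u) * g false := by
  have := isProbabilityMeasure_seedLaw h0 h1
  rw [integral_fun_fst (fun x : V → Bool => g (x u))]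
  have h := integral_seedLaw_prod h0 h1 {u} (fun _ => g)
  simp only [Finset.prod_singleton] at h
  simp [h]

/-! ### Accuracy of the learned weights -/

/-- Places both conditional activation probabilities in `[0, 1]`, as required of the centring
constants in the concentration bound. -/
theorem probNot_bounds {w : V → V → ℝ} (hw : IsLTWeight w) {q : V → ℝ}
    (h0 : ∀ u, 0 ≤ q u) (h1 : ∀ u, q u ≤ 1) (u v : V) :
    0 ≤ probNot w q u v ∧ probNot w q u v + (1 - q v) * w u v ≤ 1 := by
  have hs0 : 0 ≤ ∑ a ∈ Finset.univ.erase u, w a v * q a :=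
    Finset.sum_nonneg fun a _ => mul_nonneg (hw.nonneg a v) (h0 a)
  have hs1 : w u v + ∑ a ∈ Finset.univ.erase u, w a v * q a ≤ 1 := by
    refine le_trans ?_ (hw.normalized v)
    rw [← Finset.add_sum_erase _ _ (Finset.mem_univ u)]
    gcongr with a
    exact mul_le_of_le_one_right (hw.nonneg a v) (h1 a)
  have hv : 0 ≤ 1 - q v := sub_nonneg.mpr (h1 v)
  refine ⟨add_nonneg (h0 v) (mul_nonneg hv hs0), ?_⟩
  have := mul_le_mul_of_nonneg_left hs1 hv
  unfold probNot
  linarith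

/-- Concentration of the number of activations of `v`, counted with a weight `g` that depends on
whether `u` is a seed. -/
theorem measureReal_abs_sum_mul_actInd_le {w : V → V → ℝ} (hw : IsLTWeight w) {q : V → ℝ}
    (h0 : ∀ u, 0 ≤ q u) (h1 : ∀ u, q u ≤ 1) {u v : V} (huv : u ≠ v) {g : Bool → ℝ}
    (hg : ∀ b, g b ∈ Set.Icc (0 : ℝ) 1) {s p : ℝ} (hs : s = q u * g true + (1 - q u) * g false)
    (hp : p ∈ Set.Icc (0 : ℝ) 1)
    (hmean : s * probNot w q u v + (1 - q v) * w u v * (q u * g true) = s * p)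
    {c : ℝ} (hc0 : 0 ≤ c) (hc1 : c ≤ 2) (t : ℕ) :
    (sampleLaw q t).real
      {ω | t * s * c < |∑ i, g ((ω i).1 u) * (actInd w v (ω i) - p)|} ≤
      2 * Real.exp (-(t * s * c ^ 2 / 4)) := by
  have := isProbabilityMeasure_seedLaw h0 h1
  have hgm : Measurable fun p : (V → Bool) × (V → ℝ) => g (p.1 u) :=
    (measurable_of_countable g).comp ((measurable_pi_apply u).comp measurable_fst)
  have hg0 : ∀ b, 0 ≤ g b := fun b => (hg b).1
  have hap : ∀ x, |actInd w v x - p| ≤ 1 := fun x => by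
    have := actInd_mem w v x
    exact abs_le.mpr ⟨by linarith [this.1, hp.2], by linarith [this.2, hp.1]⟩
  have hX1 : ∀ x : (V → Bool) × (V → ℝ), |g (x.1 u) * (actInd w v x - p)| ≤ g (x.1 u) := fun x => by
    rw [abs_mul, abs_of_nonneg (hg0 _)]
    exact mul_le_of_le_one_right (hg0 _) (hap x)
  have hga : Measurable fun x : (V → Bool) × (V → ℝ) => g (x.1 u) * actInd w v x :=
    hgm.mul (measurable_actInd hw.nonneg v)
  have hXm : Measurable fun x : (V → Bool) × (V → ℝ) => g (x.1 u) * (actInd w v x - p) :=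
    hgm.mul ((measurable_actInd hw.nonneg v).sub_const p)
  have hgi : Integrable (fun x : (V → Bool) × (V → ℝ) => g (x.1 u))
      ((seedLaw q).prod (thresholdLaw V)) := by
    refine Integrable.of_bound hgm.aestronglyMeasurable 1 (ae_of_all _ fun x => ?_)
    rw [Real.norm_eq_abs, abs_of_nonneg (hg0 _)]
    exact (hg _).2
  have hXi : Integrable (fun x : (V → Bool) × (V → ℝ) => g (x.1 u) * (actInd w v x - p))
      ((seedLaw q).prod (thresholdLaw V)) :=
    hgi.mono' hXm.aestronglyMeasurable (ae_of_all _ hX1)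
  have hgai : Integrable (fun x : (V → Bool) × (V → ℝ) => g (x.1 u) * actInd w v x)
      ((seedLaw q).prod (thresholdLaw V)) := by
    refine hgi.mono' hga.aestronglyMeasurable (ae_of_all _ fun x => ?_)
    have := actInd_mem w v x
    rw [Real.norm_eq_abs, abs_mul, abs_of_nonneg (hg0 _), abs_of_nonneg this.1]
    exact mul_le_of_le_one_right (hg0 _) this.2
  refine measureReal_le_abs_sum_le hXm (fun x => (hX1 x).trans (hg _).2) ?_ ?_ hc0 hc1 t
  · simp_rw [mul_sub]
    rw [integral_sub hgai (hgi.mul_const p), integral_mul_actInd hw h0 h1 huv, integral_mul_const,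
      integral_bit_comp h0 h1, ← hs, hmean, sub_self]
  · refine (integral_mono hXi.abs hgi hX1).trans ?_
    rw [integral_bit_comp h0 h1, hs]

theorem measureReal_abs_sum_seedInd_le {q : V → ℝ} (h0 : ∀ u, 0 ≤ q u) (h1 : ∀ u, q u ≤ 1) (u : V)
    {c : ℝ} (hc0 : 0 ≤ c) (hc1 : c ≤ 2) (t : ℕ) :
    (sampleLaw q t).real {ω | t * 1 * c < |∑ i, (seedInd u (ω i) - q u)|} ≤
      2 * Real.exp (-(t * 1 * c ^ 2 / 4)) := by
  have := isProbabilityMeasure_seedLaw h0 h1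
  have hX1 : ∀ x, |seedInd u x - q u| ≤ 1 := fun x => by
    have := seedInd_mem u x
    exact abs_le.mpr ⟨by linarith [this.1, h1 u], by linarith [this.2, h0 u]⟩
  have hXm : Measurable fun x => seedInd u x - q u := (measurable_seedInd u).sub_const _
  refine measureReal_le_abs_sum_le hXm hX1 ?_ ?_ hc0 hc1 t
  · have h := integral_bit_comp h0 h1 u fun b => bit b - q u
    refine h.trans ?_
    simp [bit]
    ring
  · have hXi : Integrable (fun x => seedInd u x - q u) ((seedLaw q).prod (thresholdLaw V)) :=
      Integrable.of_bound hXm.aestronglyMeasurable 1 (ae_of_all _ hX1)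
    exact (integral_mono hXi.abs (integrable_const 1) hX1).trans (by simp)

theorem qHat_observedCascades (w : V → V → ℝ) {t : ℕ} (ω : Fin t → (V → Bool) × (V → ℝ)) (u : V) :
    qHat (observedCascades w ω) u = (∑ i, seedInd u (ω i)) / t := by
  simp [qHat, observedCascades, cascade, seedInd, bit]

theorem actInd_eq_ite (w : V → V → ℝ) {t : ℕ} (ω : Fin t → (V → Bool) × (V → ℝ)) (v : V)
    (i : Fin t) : actInd w v (ω i) = if v ∈ observedCascades w ω i 1 then 1 else 0 := rfl

theorem apHat_observedCascades (w : V → V → ℝ) {t : ℕ} (ω : Fin t → (V → Bool) × (V → ℝ)) (v : V) :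
    apHat (observedCascades w ω) v = (∑ i, actInd w v (ω i)) / t := by
  simp [apHat, actInd_eq_ite]

theorem apHatNot_observedCascades (w : V → V → ℝ) {t : ℕ} (ω : Fin t → (V → Bool) × (V → ℝ))
    (v u : V) : apHatNot (observedCascades w ω) v u =
      (∑ i, (1 - seedInd u (ω i)) * actInd w v (ω i)) / (t - ∑ i, seedInd u (ω i)) := by
  have h1 : ((Finset.univ.filter fun i => u ∉ observedCascades w ω i 0).card : ℝ) =
      t - ∑ i, seedInd u (ω i) := by
    have : ∑ i, (1 - seedInd u (ω i)) = t - ∑ i, seedInd u (ω i) := by simp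
    rw [← this, Finset.card_filter, Nat.cast_sum]
    refine Finset.sum_congr rfl fun i _ => ?_
    by_cases h : (ω i).1 u = true <;> simp [observedCascades, cascade, seedInd, bit, h]
  have h2 : ((Finset.univ.filter fun i => u ∉ observedCascades w ω i 0 ∧
      v ∈ observedCascades w ω i 1).card : ℝ) =
      ∑ i, (1 - seedInd u (ω i)) * actInd w v (ω i) := by
    rw [Finset.card_filter, Nat.cast_sum]
    refine Finset.sum_congr rfl fun i _ => ?_
    have h0 : u ∈ observedCascades w ω i 0 ↔ (ω i).1 u = true := by
      simp [observedCascades, cascade]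
    by_cases h : (ω i).1 u = true <;> simp [h0, seedInd, bit, h, actInd_eq_ite]
  rw [apHatNot, h1, h2]

/-- Error propagation in the weight estimator: `N` and `M` are the numbers of cascades in which `u`
and `v` are seeds, `A₁` and `A₀` the numbers of cascades in which `v` is activated together with,
respectively without, the seed `u`. -/
theorem abs_estimate_sub_le {t N M A₁ A₀ q q' p w γ η : ℝ} (ht : 0 < t) (hγ : 0 < γ)
    (hq : γ ≤ q ∧ q ≤ 1 - γ) (hq' : q' ≤ 1 - γ) (hw0 : 0 ≤ w) (hw1 : w ≤ 1)
    (hη0 : 0 ≤ η) (hη : η ≤ 1 / 4)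
    (hN : |N - t * q| ≤ t * (η * γ / 4)) (hM : |M - t * q'| ≤ t * (η * γ / 4))
    (hA₁ : |A₁ - N * (p + (1 - q') * w)| ≤ t * q * (15 / 64 * (η * γ)))
    (hA₀ : |A₀ - (t - N) * p| ≤ t * (1 - q) * (15 / 64 * (η * γ))) :
    |((A₁ + A₀) / t - A₀ / (t - N)) / (N / t * (1 - M / t)) - w| ≤ η := by
  have hx0 : 0 ≤ η * γ := mul_nonneg hη0 hγ.le
  have hx : t * (η * γ / 4) ≤ t * γ / 16 := by
    nlinarith [mul_le_mul_of_nonneg_right hη (mul_pos ht hγ).le]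
  have htq : t * γ ≤ t * q := mul_le_mul_of_nonneg_left hq.1 ht.le
  have htq1 : t * γ ≤ t * (1 - q) := mul_le_mul_of_nonneg_left (by linarith [hq.2]) ht.le
  have htq' : t * γ ≤ t * (1 - q') := mul_le_mul_of_nonneg_left (by linarith) ht.le
  have htγ : 0 < t * γ := mul_pos ht hγ
  obtain ⟨hN1, hN2⟩ := abs_le.mp hN
  obtain ⟨hM1, hM2⟩ := abs_le.mp hM
  -- Since `η ≤ 1 / 4`, the seed counts err by at most `t * γ / 16`, so `N` and `t - N` keep 15/16
  -- of their means. Then `15 / 64 = 15 / 16 * (1 / 4)` turns count errors into frequency errors `η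
  -- * γ / 4`.
  have hNq : 15 / 16 * (t * q) ≤ N := by linarith
  have hNq' : 15 / 16 * (t * (1 - q)) ≤ t - N := by linarith
  have hN0 : 0 < N := by linarith
  have hN0' : 0 < t - N := by linarith
  obtain ⟨m, rfl⟩ : ∃ m, M = t * m := ⟨M / t, by field_simp⟩
  obtain ⟨a₁, rfl⟩ : ∃ a, A₁ = N * a := ⟨A₁ / N, by field_simp⟩
  obtain ⟨a₀, rfl⟩ : ∃ a, A₀ = (t - N) * a := ⟨A₀ / (t - N), by field_simp⟩
  have hm : |m - q'| ≤ η * γ / 4 := by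
    rw [← mul_sub, abs_mul, abs_of_pos ht] at hM
    exact le_of_mul_le_mul_left hM ht
  have ha₁ : |a₁ - (p + (1 - q') * w)| ≤ η * γ / 4 := by
    rw [← mul_sub, abs_mul, abs_of_pos hN0] at hA₁
    refine le_of_mul_le_mul_left (hA₁.trans ?_) hN0
    nlinarith [mul_le_mul_of_nonneg_right hNq hx0]
  have ha₀ : |a₀ - p| ≤ η * γ / 4 := by
    rw [← mul_sub, abs_mul, abs_of_pos hN0'] at hA₀
    refine le_of_mul_le_mul_left (hA₀.trans ?_) hN0'
    nlinarith [mul_le_mul_of_nonneg_right hNq' hx0]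
  have hm1 : 15 / 16 * γ ≤ 1 - m := by
    have := (abs_le.mp hm).2
    nlinarith
  have hm0 : 0 < 1 - m := by linarith
  have hmne : 1 - m ≠ 0 := hm0.ne'
  -- The numerator equals `N / t * (a₁ - a₀)`, so `N / t` cancels and the error of the estimate of
  -- `q u` drops out.
  have hest : ((N * a₁ + (t - N) * a₀) / t - (t - N) * a₀ / (t - N)) /
      (N / t * (1 - t * m / t)) - w = (a₁ - a₀ - (1 - m) * w) / (1 - m) := by
    rw [mul_div_cancel_left₀ _ hN0'.ne', mul_div_cancel_left₀ _ ht.ne']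
    field_simp
    ring
  rw [hest, abs_div, abs_of_pos hm0, div_le_iff₀ hm0]
  have hmw : |(m - q') * w| ≤ η * γ / 4 := by
    rw [abs_mul, abs_of_nonneg hw0]
    exact (mul_le_of_le_one_right (abs_nonneg _) hw1).trans hm
  have hsum : |a₁ - a₀ - (1 - m) * w| ≤ 3 / 4 * (η * γ) := by
    rw [abs_le] at *
    constructor <;> linarith [ha₁.1, ha₁.2, ha₀.1, ha₀.2, hmw.1, hmw.2]
  -- Three errors of `η * γ / 4` against a denominator of at least `15 / 16 * γ`.
  nlinarith [mul_le_mul_of_nonneg_left hm1 hη0]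

/-- With the stated number of samples, the weight of a given edge is learned up to `η`. -/
theorem measureReal_abs_wHat_sub_le {w : V → V → ℝ} (hw : IsLTWeight w) {q : V → ℝ} {γ : ℝ}
    (hγ0 : 0 < γ) (hγ1 : γ ≤ 1 / 2) (hq : ∀ u, γ ≤ q u ∧ q u ≤ 1 - γ) {η L : ℝ} (hη0 : 0 < η)
    (hη1 : η ≤ 1 / 4) (hL : 0 < L) {t : ℕ} (ht : 256 * L ≤ t * (η ^ 2 * γ ^ 3)) {u v : V}
    (huv : u ≠ v) :
    (sampleLaw q t).real {ω | η < |wHat (observedCascades w ω) u v - w u v|} ≤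
      8 * Real.exp (-(2 * L)) := by
  have h0 : ∀ u, 0 ≤ q u := fun u => hγ0.le.trans (hq u).1
  have h1 : ∀ u, q u ≤ 1 := fun u => (hq u).2.trans (by linarith)
  have := isProbabilityMeasure_seedLaw h0 h1
  have : IsProbabilityMeasure (sampleLaw q t) := by unfold sampleLaw; infer_instance
  have ht0 : (0 : ℝ) < t := by
    have : 0 < t * (η ^ 2 * γ ^ 3) := by linarith
    exact pos_of_mul_pos_left this (by positivity)
  have hx0 : 0 ≤ η * γ := by positivity
  have hx1 : η * γ ≤ 1 := by nlinarith
  have hK : 0 ≤ t * (η ^ 2 * γ ^ 2) := by positivity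
  have hexp : ∀ s c : ℝ, 8 * L ≤ t * s * c ^ 2 →
      2 * Real.exp (-(t * s * c ^ 2 / 4)) ≤ 2 * Real.exp (-(2 * L)) := by
    intro s c h
    gcongr
    linarith
  have hexp1 : 8 * L ≤ t * 1 * (η * γ / 4) ^ 2 := by
    have := mul_le_mul_of_nonneg_left hγ1 hK
    nlinarith
  -- `256 * (15 / 64) ^ 2 > 14`, which exceeds the required 8.
  have hexp2 : ∀ s, γ ≤ s → 8 * L ≤ t * s * (15 / 64 * (η * γ)) ^ 2 := by
    intro s hs
    have := mul_le_mul_of_nonneg_left hs hK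
    nlinarith
  obtain ⟨hp0, hp1⟩ := probNot_bounds hw h0 h1 u v
  have hwv : 0 ≤ (1 - q v) * w u v := mul_nonneg (sub_nonneg.mpr (h1 v)) (hw.nonneg u v)
  have hw1 : w u v ≤ 1 :=
    (Finset.single_le_sum (fun a _ => hw.nonneg a v) (Finset.mem_univ u)).trans (hw.normalized v)
  have b1 := (measureReal_abs_sum_seedInd_le h0 h1 u (c := η * γ / 4) (by linarith) (by linarith)
    t).trans (hexp _ _ hexp1)
  have b2 := (measureReal_abs_sum_seedInd_le h0 h1 v (c := η * γ / 4) (by linarith) (by linarith)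
    t).trans (hexp _ _ hexp1)
  have b3 := (measureReal_abs_sum_mul_actInd_le hw h0 h1 huv (g := bit) (s := q u)
    (p := probNot w q u v + (1 - q v) * w u v) (c := 15 / 64 * (η * γ))
    (by intro b; cases b <;> simp [bit]) (by simp [bit]) ⟨by linarith, hp1⟩
    (by simp [bit]; ring) (by linarith) (by linarith) t).trans (hexp _ _ (hexp2 _ (hq u).1))
  have b4 := (measureReal_abs_sum_mul_actInd_le hw h0 h1 huv (g := fun b => 1 - bit b)
    (s := 1 - q u) (p := probNot w q u v) (c := 15 / 64 * (η * γ))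
    (by intro b; cases b <;> simp [bit]) (by simp [bit]) ⟨hp0, by linarith⟩
    (by simp [bit]) (by linarith) (by linarith) t).trans
    (hexp _ _ (hexp2 _ (by linarith [(hq u).2])))
  refine (measureReal_mono (s₂ := _ ∪ _ ∪ (_ ∪ _)) (fun ω hω => ?_)).trans
    ((measureReal_union_le _ _).trans ((add_le_add
      ((measureReal_union_le _ _).trans (add_le_add b1 b2))
      ((measureReal_union_le _ _).trans (add_le_add b3 b4))).trans (by linarith)))
  by_contra hn
  simp only [Set.mem_union, Set.mem_ofPred_eq, not_or, not_lt] at hn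
  obtain ⟨⟨e1, e2⟩, e3, e4⟩ := hn
  refine absurd (Set.mem_ofPred_eq ▸ hω : η < _) (not_lt.mpr ?_)
  have hsplit : ∑ i, actInd w v (ω i) = ∑ i, seedInd u (ω i) * actInd w v (ω i) +
      ∑ i, (1 - seedInd u (ω i)) * actInd w v (ω i) := by
    rw [← Finset.sum_add_distrib]
    exact Finset.sum_congr rfl fun i _ => by ring
  rw [wHat, qHat_observedCascades, qHat_observedCascades, apHat_observedCascades,
    apHatNot_observedCascades, hsplit]
  refine abs_estimate_sub_le (q := q u) (q' := q v) (p := probNot w q u v) ht0 hγ0 (hq u)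
    (hq v).2 (hw.nonneg u v) hw1 hη0.le hη1 ?_ ?_ ?_ ?_
  · simpa [Finset.sum_sub_distrib] using e1
  · simpa [Finset.sum_sub_distrib] using e2
  · simpa [mul_sub, Finset.sum_sub_distrib, ← Finset.sum_mul, seedInd] using e3
  · simpa [mul_sub, Finset.sum_sub_distrib, ← Finset.sum_mul, seedInd] using e4

/-- Union bound over edges; the factor 2 in `exp (-(2 * L))` is there to absorb `n ^ 2`. -/
theorem measureReal_exists_abs_wHat_sub_le {w : V → V → ℝ} (hw : IsLTWeight w) {q : V → ℝ} {γ : ℝ}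
    (hγ0 : 0 < γ) (hγ1 : γ ≤ 1 / 2) (hq : ∀ u, γ ≤ q u ∧ q u ≤ 1 - γ) {η L : ℝ} (hη0 : 0 < η)
    (hη1 : η ≤ 1 / 4) (hL : 0 < L) {t : ℕ} (ht : 256 * L ≤ t * (η ^ 2 * γ ^ 3)) :
    (sampleLaw q t).real
      {ω | ∃ u v, 0 < w u v ∧ η < |wHat (observedCascades w ω) u v - w u v|} ≤
      (Fintype.card V : ℝ) ^ 2 * (8 * Real.exp (-(2 * L))) := by
  have h0 : ∀ u, 0 ≤ q u := fun u => hγ0.le.trans (hq u).1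
  have h1 : ∀ u, q u ≤ 1 := fun u => (hq u).2.trans (by linarith)
  have := isProbabilityMeasure_seedLaw h0 h1
  have : IsProbabilityMeasure (sampleLaw q t) := by unfold sampleLaw; infer_instance
  have hsub : {ω | ∃ u v, 0 < w u v ∧ η < |wHat (observedCascades w ω) u v - w u v|} ⊆
      ⋃ e ∈ edges w, {ω : Fin t → (V → Bool) × (V → ℝ) |
        η < |wHat (observedCascades w ω) e.1 e.2 - w e.1 e.2|} := by
    rintro ω ⟨u, v, huv, h⟩
    exact Set.mem_biUnion (x := (u, v)) (by simpa [edges] using huv) h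
  refine (measureReal_mono hsub (measure_ne_top _ _)).trans ((measureReal_biUnion_finset_le _ _).trans ?_)
  refine (Finset.sum_le_card_nsmul _ _ (8 * Real.exp (-(2 * L))) fun e he => ?_).trans ?_
  · refine measureReal_abs_wHat_sub_le hw hγ0 hγ1 hq hη0 hη1 hL ht fun h => ?_
    have : 0 < w e.1 e.2 := by simpa [edges] using he
    rw [h, hw.noLoop] at this
    exact lt_irrefl _ this
  · rw [nsmul_eq_mul]
    gcongr
    have : (edges w).card ≤ Fintype.card V ^ 2 := by
      refine (Finset.card_le_univ _).trans ?_
      rw [Fintype.card_prod, sq]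
    exact_mod_cast this

/-! ### From accurate weights to a good seed set -/

/-- Clipping at 0 does not increase the error since true weights are non-negative. At most `D` edges
enter a node, so its in-weight sum is at most `1 + β / 2` before rescaling. Estimation and rescaling
each cost at most `β / 2` per node. -/
theorem isLTWeight_and_sum_abs_sub_le {w x : V → V → ℝ} (hw : IsLTWeight w) {η β : ℝ} (hη : 0 ≤ η)
    (hβ : maxInDegree w * η ≤ β / 2) (hx : ∀ u v, 0 < w u v → |x u v - w u v| ≤ η)
    {w' : V → V → ℝ}
    (hw' : ∀ u v, w' u v = if (u, v) ∈ edges w then max 0 (x u v) / (1 + β / 2) else 0) :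
    IsLTWeight w' ∧ ∀ v, ∑ u, |w u v - w' u v| ≤ β := by
  have hβ0 : 0 ≤ β / 2 := (mul_nonneg (Nat.cast_nonneg _) hη).trans hβ
  have hsumη : ∀ v, ∑ u, (if 0 < w u v then η else 0) ≤ β / 2 := by
    intro v
    rw [← Finset.sum_filter, Finset.sum_const, nsmul_eq_mul]
    refine le_trans ?_ hβ
    gcongr
    exact Finset.le_sup (f := fun v => (inNeighbors w v).card) (Finset.mem_univ v)
  have hx' : ∀ u v, 0 < w u v → |max 0 (x u v) - w u v| ≤ η := fun u v h => by
    obtain ⟨h1, h2⟩ := abs_le.mp (hx u v h)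
    refine abs_le.mpr ⟨by linarith [le_max_right 0 (x u v)], ?_⟩
    rcases max_cases 0 (x u v) with ⟨h3, -⟩ | ⟨h3, -⟩ <;> rw [h3] <;> linarith
  have hwe : ∀ u v, w' u v = if 0 < w u v then max 0 (x u v) / (1 + β / 2) else 0 := by
    intro u v
    rw [hw']
    simp [edges]
  have hw0 : ∀ u v, ¬ 0 < w u v → w u v = 0 := fun u v h =>
    le_antisymm (not_lt.mp h) (hw.nonneg u v)
  have hb1 : 0 < 1 + β / 2 := by linarith
  have hnn : ∀ u v, 0 ≤ w' u v := fun u v => by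
    rw [hwe]
    split_ifs
    · exact div_nonneg (le_max_left _ _) hb1.le
    · exact le_rfl
  refine ⟨⟨hnn, fun v => ?_, fun v => ?_⟩, fun v => ?_⟩
  · rw [hwe, if_neg]
    simp [hw.noLoop]
  · have hle : ∀ u, w' u v ≤ (w u v + if 0 < w u v then η else 0) / (1 + β / 2) := by
      intro u
      rw [hwe]
      split_ifs with h
      · gcongr
        linarith [(abs_le.mp (hx' u v h)).2]
      · simp [hw0 u v h]
    refine (Finset.sum_le_sum fun u _ => hle u).trans ?_
    rw [← Finset.sum_div, Finset.sum_add_distrib, div_le_one hb1]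
    exact add_le_add (hw.normalized v) (hsumη v)
  · have hle : ∀ u, |w u v - w' u v| ≤ β / 2 * w u v + if 0 < w u v then η else 0 := by
      intro u
      rw [hwe]
      split_ifs with h
      · have he : w u v - max 0 (x u v) / (1 + β / 2) =
            (β / 2 * w u v - (max 0 (x u v) - w u v)) / (1 + β / 2) := by
          rw [eq_div_iff hb1.ne', sub_mul, div_mul_cancel₀ _ hb1.ne']
          ring
        rw [he, abs_div, abs_of_pos hb1, div_le_iff₀ hb1]
        have h1 := hx' u v h
        have h2 : 0 ≤ β / 2 * w u v := mul_nonneg hβ0 h.le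
        have h3 : 0 ≤ (β / 2 * w u v + η) * (β / 2) := by positivity
        rw [abs_le] at h1 ⊢
        constructor <;> linarith [h1.1, h1.2]
      · simp [hw0 u v h]
    refine (Finset.sum_le_sum fun u _ => hle u).trans ?_
    rw [Finset.sum_add_distrib, ← Finset.mul_sum]
    have := mul_le_mul_of_nonneg_left (hw.normalized v) hβ0
    linarith [hsumη v]

/-- Converts the additive loss `ε * k` into the multiplicative loss `ε * σ(S*)`. -/
theorem le_influence_of_isOptimal {w : V → V → ℝ} (hw : ∀ u v, 0 ≤ w u v) {k : ℕ}
    (hk : k ≤ Fintype.card V) {S : Finset V} (hS : IsOptimal w k S) : (k : ℝ) ≤ influence w S := by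
  obtain ⟨T, -, hT⟩ := Finset.exists_subset_card_eq (s := (Finset.univ : Finset V)) hk
  calc (k : ℝ) = T.card := by rw [hT]
    _ ≤ influence w T := card_le_influence hw T
    _ ≤ influence w S := hS.2 T hT.le

/-- An approximation algorithm run on a nearby network is almost as good on the true network. -/
theorem influence_approx_of_close {w w' : V → V → ℝ} (hw : IsLTWeight w) (hw' : IsLTWeight w')
    {β ε : ℝ} (hβ0 : 0 ≤ β) (hβ : ∀ v, ∑ u, |w u v - w' u v| ≤ β) {k : ℕ} (hk1 : 1 ≤ k)
    (hkn : k ≤ Fintype.card V) (hε : 2 * ((Fintype.card V : ℝ) ^ 3 * β) ≤ ε * k) (hε0 : 0 ≤ ε)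
    {κ : ℝ} (hκ0 : 0 ≤ κ) (hκ1 : κ ≤ 1) {A : (V → V → ℝ) → ℕ → Finset V}
    (hA : IsApproxAlgorithm κ A) {S : Finset V} (hS : IsOptimal w k S) :
    (κ - ε) * influence w S ≤ influence w (A w' k) := by
  obtain ⟨T, hT⟩ := exists_isOptimal w' k
  have h1 := (hA w' k hw' hk1 hkn).2 T hT
  have h2 := hT.2 S hS.1
  have h3 := (abs_le.mp (abs_influence_sub_influence_le hw hw'.nonneg hβ0 hβ S)).2
  have h4 := (abs_le.mp (abs_influence_sub_influence_le hw hw'.nonneg hβ0 hβ (A w' k))).1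
  have h5 := mul_le_mul_of_nonneg_left (le_influence_of_isOptimal hw.nonneg hkn hS) hε0
  have h6 : κ * (influence w S - influence w' T) ≤ (Fintype.card V : ℝ) ^ 3 * β := by
    have h7 : 0 ≤ (Fintype.card V : ℝ) ^ 3 * β := by positivity
    calc _ ≤ κ * ((Fintype.card V : ℝ) ^ 3 * β) :=
          mul_le_mul_of_nonneg_left (by linarith) hκ0
      _ ≤ _ := mul_le_of_le_one_left h7 hκ1
  linarith

theorem imsLT_guarantee {w : V → V → ℝ} (hw : IsLTWeight w) {ε : ℝ} (hε0 : 0 ≤ ε) {k : ℕ}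
    (hk1 : 1 ≤ k) (hkn : k ≤ Fintype.card V) {κ : ℝ} (hκ0 : 0 ≤ κ) (hκ1 : κ ≤ 1)
    {A : (V → V → ℝ) → ℕ → Finset V} (hA : IsApproxAlgorithm κ A) {S : Finset V}
    (hS : IsOptimal w k S) {t : ℕ} {C : Fin t → ℕ → Finset V} {η : ℝ} (hη : 0 ≤ η)
    (hηε : maxInDegree w * η ≤ (ε * k / (2 * (Fintype.card V : ℝ) ^ 3)) / 2)
    (hC : ∀ u v, 0 < w u v → |wHat C u v - w u v| ≤ η) :
    (imsLT C A (edges w) ε k).card ≤ k ∧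
      (κ - ε) * influence w S ≤ influence w (imsLT C A (edges w) ε k) := by
  obtain ⟨h1, h2⟩ := isLTWeight_and_sum_abs_sub_le hw hη hηε hC (w' := surrogate C (edges w) ε k)
    fun u v => rfl
  have hn : (0 : ℝ) < Fintype.card V := by exact_mod_cast lt_of_lt_of_le hk1 hkn
  refine ⟨(hA _ k h1 hk1 hkn).1,
    influence_approx_of_close hw h1 (by positivity) h2 hk1 hkn (le_of_eq ?_) hε0 hκ0 hκ1 hA hS⟩
  field_simp

end LinearThreshold

/-! ### Choice of the accuracy and assembly -/

theorem mainTheorem12 {V : Type*} [Fintype V] [DecidableEq V]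
    (w : V → V → ℝ) (hw : LinearThreshold.IsLTWeight w)
    (q : V → ℝ) (γ : ℝ) (hγ0 : 0 < γ) (hγ1 : γ ≤ 1 / 2)
    (hq : ∀ u, γ ≤ q u ∧ q u ≤ 1 - γ)
    (ε : ℝ) (hε0 : 0 < ε) (hε1 : ε < 1)
    (δ : ℝ) (hδ0 : 0 < δ) (hδ1 : δ < 1)
    (k : ℕ) (hk1 : 1 ≤ k) (hkn : k ≤ Fintype.card V)
    (κ : ℝ) (hκ0 : 0 < κ) (hκ1 : κ ≤ 1)
    (A : (V → V → ℝ) → ℕ → Finset V) (hA : LinearThreshold.IsApproxAlgorithm κ A)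
    (Sstar : Finset V) (hS : LinearThreshold.IsOptimal w k Sstar)
    (t : ℕ)
    (ht : 4096 * (LinearThreshold.maxInDegree w : ℝ) ^ 2 * (Fintype.card V : ℝ) ^ 6
        / (ε ^ 2 * γ ^ 3 * (k : ℝ) ^ 2) * Real.log (12 * (Fintype.card V : ℝ) / δ) ≤ (t : ℝ)) :
    1 - δ ≤ (LinearThreshold.sampleLaw q t).real
      {ω | (LinearThreshold.imsLT (LinearThreshold.observedCascades w ω) A
              (LinearThreshold.edges w) ε k).card ≤ k ∧
        (κ - ε) * LinearThreshold.influence w Sstar ≤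
          LinearThreshold.influence w
            (LinearThreshold.imsLT (LinearThreshold.observedCascades w ω) A
              (LinearThreshold.edges w) ε k)} := by
  have := LinearThreshold.isProbabilityMeasure_seedLaw (q := q) (fun u => hγ0.le.trans (hq u).1)
    fun u => (hq u).2.trans (by linarith)
  have : IsProbabilityMeasure (LinearThreshold.sampleLaw q t) := by
    unfold LinearThreshold.sampleLaw; infer_instance
  set n := (Fintype.card V : ℝ) with hn
  set D := LinearThreshold.maxInDegree w with hD
  have hk1' : (1 : ℝ) ≤ k := by exact_mod_cast hk1
  have hkn' : (k : ℝ) ≤ n := Nat.cast_le.mpr hkn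
  have hn1 : 1 ≤ n := hk1'.trans hkn'
  have hgood := fun (ω : Fin t → (V → Bool) × (V → ℝ)) (η : ℝ) =>
    LinearThreshold.imsLT_guarantee hw hε0.le hk1 hkn hκ0.le hκ1 hA hS
      (C := LinearThreshold.observedCascades w ω) (η := η)
  -- For `D = 0` the sample bound is vacuous and `η` below would divide by 0, but there is nothing
  -- to learn: every sample succeeds.
  rcases Nat.eq_zero_or_pos D with hD0 | hD0
  · have hno : ∀ u v, ¬ 0 < w u v := by
      intro u v h
      have h1 := Finset.le_sup (f := fun v => (LinearThreshold.inNeighbors w v).card)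
        (Finset.mem_univ v)
      have h2 : 0 < (LinearThreshold.inNeighbors w v).card :=
        Finset.card_pos.mpr ⟨u, by simpa [LinearThreshold.inNeighbors] using h⟩
      exact absurd (h2.trans_le (h1.trans hD0.le)) (lt_irrefl 0)
    refine le_trans (sub_le_self 1 hδ0.le) (le_of_eq ?_)
    rw [← probReal_univ (μ := LinearThreshold.sampleLaw q t)]
    congr 1
    refine (Set.eq_univ_of_forall fun ω => hgood ω 0 le_rfl ?_ fun u v h => absurd h (hno u v)).symm
    rw [mul_zero]
    positivity
  · have hD1 : (1 : ℝ) ≤ D := by exact_mod_cast hD0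
    set L := Real.log (12 * n / δ) with hL
    have hq1 : 1 < 12 * n / δ := by
      rw [one_lt_div hδ0]
      linarith
    -- Chosen so that `D * η = ε' / 2` with `ε' = ε * k / (2 * n ^ 3)`; then `4096 / 4 ^ 2 = 256`
    -- matches the learning bound.
    set η := ε * k / (4 * n ^ 3 * D) with hη
    have hη0 : 0 < η := by positivity
    have hη1 : η ≤ 1 / 4 := by
      rw [hη, div_le_div_iff₀ (by positivity) (by norm_num)]
      have h1 : ε * k ≤ n := by nlinarith
      have h2 : n ≤ n ^ 3 := le_self_pow₀ hn1 (by norm_num)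
      have h3 : n ^ 3 ≤ n ^ 3 * D := le_mul_of_one_le_right (by positivity) hD1
      linarith
    have ht' : 256 * L ≤ t * (η ^ 2 * γ ^ 3) := by
      have h := mul_le_mul_of_nonneg_right ht (by positivity : 0 ≤ η ^ 2 * γ ^ 3)
      refine le_trans (le_of_eq ?_) h
      rw [hη]
      field_simp
      ring
    have hbad := LinearThreshold.measureReal_exists_abs_wHat_sub_le hw hγ0 hγ1 hq hη0 hη1
      (Real.log_pos hq1) ht'
    have hsmall : n ^ 2 * (8 * Real.exp (-(2 * L))) ≤ δ := by
      have : Real.exp (-(2 * L)) = (δ / (12 * n)) ^ 2 := by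
        rw [show -(2 * L) = (2 : ℕ) * (-L) by push_cast; ring, Real.exp_nat_mul, Real.exp_neg, hL,
          Real.exp_log (by positivity), inv_div]
      rw [this]
      have h2 : n ^ 2 * (8 * (δ / (12 * n)) ^ 2) = δ * (δ / 18) := by
        field_simp
        norm_num
      rw [h2]
      exact mul_le_of_le_one_right hδ0.le (by linarith)
    -- Covering the whole space by the failure and success events needs only subadditivity, not the
    -- measurability of either.
    have hcover := measureReal_mono (μ := LinearThreshold.sampleLaw q t) (s₁ := Set.univ)
      (s₂ := _ ∪ _) (fun ω _ => (Classical.em (∃ u v, 0 < w u v ∧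
        η < |LinearThreshold.wHat (LinearThreshold.observedCascades w ω) u v - w u v|)).imp_right
        fun h => hgood ω η hη0.le (le_of_eq ?_) fun u v huv => not_lt.mp fun hlt =>
          h ⟨u, v, huv, hlt⟩)
    · rw [probReal_univ] at hcover
      have := hcover.trans (measureReal_union_le _ _)
      have hb := hbad.trans hsmall
      exact sub_le_iff_le_add'.mpr (this.trans (add_le_add_left hb _))
    · rw [hη, ← hn, ← hD]
      field_simp
      norm_num
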